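/- Let $G=(V,E,w)$ be a finite simple undirected graph with edge weights $w\ge 0$, and let $q>0$. A spanning rooted forest $F$ of $G$ is a cycle-free subgraph with vertex set $V$, together with the choice of one root in each of its trees; its weight is $w(F)=\prod_{e\in F}w(e)$, and $\Pi(F)$ is the partition of $V$ into the vertex sets of the trees of $F$. The loop-erased partition $\Pi_q$ of $G$ is the random partition of $V$ with law $$\mu_q(\Pi)=\frac{q^{|\Pi|}\sum_{F:\,\Pi(F)=\Pi}w(F)}{Z(q)},$$ where $|\Pi|$ is the number of blocks of $\Pi$ and $Z(q)$ is the normalizing constant. For $N\ge 1$, $q>0$ and $w>0$ let $\mathcal K_N$ be the complete graph on $[N]=\{1,\dots,N\}$ with constant edge weight $w$, and for $x\ne y$ in $[N]$ let $U^{(N)}_q(x,y)$ be the probability that $x$ and $y$ lie in different blocks of the loop-erased partition $\Pi_q$ of $\mathcal K_N$. Then for all $x\neq y$ in $[N]$ $$U^{(N)}_q(x,y)=U^{(N)}_q:=\sum_{h=1}^{N-1}\frac{q}{q+Nw}\left(\frac{Nw}{q+Nw}\right)^{h-1}\prod_{k=2}^{h}\left(1-\frac kN\right).$$ Furthermore,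 fix $z>0$ and let $q=q_N>0$ and $w=w_N>0$ depend on $N$ in such a way that $w_N=\Theta(1)$ (that is, $0<\liminf_N w_N\le\limsup_N w_N<\infty$) and $q_N\sim w_N z\sqrt N$ (that is, $q_N/(w_N z\sqrt N)\to 1$) as $N\to\infty$. Then $$\lim_{N\to\infty}U^{(N)}_{q_N}=\sqrt{2\pi}\,z\,e^{z^2/2}\,\mathbb P(Z>z),$$ where $Z$ is a standard Gaussian random variable and $U^{(N)}_{q_N}$ is the potential of $\mathcal K_N$ with edge weight $w_N$. -/

import Mathlib

open Finset Filter Topology Asymptotics MeasureTheory ProbabilityTheory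

/-- A spanning rooted forest of the graph `G` on the vertex set `V`: a subgraph of `G` without
cycles that has all of `V` as its vertices, together with a set of roots that contains exactly one
vertex of each of its trees (connected components; an isolated vertex is a tree). -/
@[ext]
structure RootedForest {V : Type*} (G : SimpleGraph V) where
  graph : SimpleGraph V
  le_graph : graph ≤ G
  acyclic : graph.IsAcyclic
  roots : Finset V
  existsUnique_root : ∀ v, ∃! r, r ∈ roots ∧ graph.Reachable v r

namespace RootedForest

variable {V : Type*} [Fintype V] {G : SimpleGraph V}

open Classical in
noncomputable instance : Fintype (RootedForest G) :=
  Fintype.ofInjective (fun F : RootedForest G => (F.graph, F.roots)) fun F F' h => by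
    rw [Prod.mk.injEq] at h
    exact RootedForest.ext h.1 h.2

open Classical in
/-- The weight `w(F) = ∏_{e ∈ F} w(e)`, the product over the (unoriented) edges of the forest. -/
noncomputable def weight (F : RootedForest G) (w : Sym2 V → ℝ) : ℝ :=
  ∏ e ∈ F.graph.edgeFinset, w e

open Classical in
/-- The partition `Π(F)` of `V` whose blocks are the vertex sets of the trees of `F`. -/
noncomputable def partition [DecidableEq V] (F : RootedForest G) :
    Finpartition (univ : Finset V) :=
  Finpartition.ofSetoid F.graph.reachableSetoid

end RootedForest

section LoopErased

variable {V : Type*} [Fintype V] [DecidableEq V]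

/-- The unnormalized mass `q ^ m * ∑_{F : Π(F) = P} w(F)` of a partition `P` with `m` blocks. -/
noncomputable def loopErasedWeight (G : SimpleGraph V) (w : Sym2 V → ℝ) (q : ℝ)
    (P : Finpartition (univ : Finset V)) : ℝ :=
  q ^ P.parts.card * ∑ F : RootedForest G with F.partition = P, F.weight w

/-- The normalizing constant `Z(q)`. -/
noncomputable def loopErasedZ (G : SimpleGraph V) (w : Sym2 V → ℝ) (q : ℝ) : ℝ :=
  ∑ P : Finpartition (univ : Finset V), loopErasedWeight G w q P

/-- The law `μ_q` of the loop-erased partition `Π_q` of the weighted graph `(V, G, w)`: the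
probability `μ_q(P)` that `Π_q = P`. -/
noncomputable def loopErasedMass (G : SimpleGraph V) (w : Sym2 V → ℝ) (q : ℝ)
    (P : Finpartition (univ : Finset V)) : ℝ :=
  loopErasedWeight G w q P / loopErasedZ G w q

/-- The pairwise interaction potential `U_q(x, y)`: the probability that `x` and `y` lie in
different blocks of the loop-erased partition `Π_q`. -/
noncomputable def pairPotential (G : SimpleGraph V) (w : Sym2 V → ℝ) (q : ℝ) (x y : V) : ℝ :=
  ∑ P : Finpartition (univ : Finset V) with P.part x ≠ P.part y, loopErasedMass G w q P

/-- The pairwise interaction potential of the complete graph on `N` vertices with constant edge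
weight `w`. -/
noncomputable def completePotential (N : ℕ) (w q : ℝ) (x y : Fin N) : ℝ :=
  pairPotential (⊤ : SimpleGraph (Fin N)) (fun _ => w) q x y

theorem loopErasedWeight_nonneg (G : SimpleGraph V) {w : Sym2 V → ℝ} (hw : ∀ e, 0 ≤ w e)
    {q : ℝ} (hq : 0 < q) (P : Finpartition (univ : Finset V)) : 0 ≤ loopErasedWeight G w q P :=
  mul_nonneg (pow_nonneg hq.le _)
    (sum_nonneg fun _ _ => prod_nonneg fun _ _ => hw _)

/-- The normalizing constant is positive: the forest of isolated vertices has weight `1`. -/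
theorem loopErasedZ_pos (G : SimpleGraph V) {w : Sym2 V → ℝ} (hw : ∀ e, 0 ≤ w e)
    {q : ℝ} (hq : 0 < q) : 0 < loopErasedZ G w q := by
  classical
  obtain ⟨F₀, hF₀⟩ : ∃ F : RootedForest G, F.graph = ⊥ :=
    ⟨{ graph := ⊥
       le_graph := bot_le
       acyclic := SimpleGraph.isAcyclic_bot
       roots := univ
       existsUnique_root := fun v =>
         ⟨v, ⟨mem_univ _, SimpleGraph.Reachable.refl _⟩, fun r hr => by
           simpa [eq_comm] using hr.2⟩ }, rfl⟩
  have hone : F₀.weight w = 1 := by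
    refine prod_eq_one fun e he => ?_
    have h := SimpleGraph.mem_edgeFinset.1 he
    simp [hF₀] at h
  refine sum_pos' (fun P _ => loopErasedWeight_nonneg G hw hq P) ⟨F₀.partition, mem_univ _, ?_⟩
  refine mul_pos (pow_pos hq _) ?_
  refine sum_pos' (fun _ _ => prod_nonneg fun _ _ => hw _) ⟨F₀, by simp, ?_⟩
  rw [hone]
  exact one_pos

/-- `μ_q` is a probability distribution on the partitions of `V`. -/
theorem loopErasedMass_nonneg_and_sum (G : SimpleGraph V) {w : Sym2 V → ℝ} (hw : ∀ e, 0 ≤ w e)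
    {q : ℝ} (hq : 0 < q) :
    (∀ P, 0 ≤ loopErasedMass G w q P) ∧
      ∑ P : Finpartition (univ : Finset V), loopErasedMass G w q P = 1 := by
  refine ⟨fun P => div_nonneg (loopErasedWeight_nonneg G hw hq P) (loopErasedZ_pos G hw hq).le, ?_⟩
  simp only [loopErasedMass, ← sum_div]
  exact div_self (loopErasedZ_pos G hw hq).ne'

end LoopErased

/-! A rooted forest on the complete graph is the same as a map sending each vertex to its parent, or
to a label if it is a root, with no cycles; a root gets weight `q`, any other vertex weight `w`.
Allow several labels `r`, of weights `c r`, and expose the value at one vertex `x`. Deleting `x`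
leaves such a map on the other vertices, with an extra label `none` of weight `w` for the vertices
attached to `x`. The total `T = ∑ c + |V| w` is unchanged by the deletion, so the recursions close
up.

They give `c r * T ^ (|V| - 1)` for the maps leading a given vertex to `r` (`mapSum_leadsTo`). For
the separation of `x` and `y` (`mapSum_leadApart`), the path of `x` is peeled off vertex by vertex:
with `m = |V| - 2`, a path with `i` further vertices avoids `y` in `m.descFactorial i` ways, and `y`
must then reach its label off this path. Dividing by `Z = q T ^ (N - 1)` gives the finite formula.

For the limit put `θ = q / (q + N w)`, so that `√N θ → z`. The sum equals the integral of a step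
function at scale `√N`, with pointwise limit `z exp (-z t) exp (-t² / 2)`. Dominated convergence
applies, and completing the square yields the Gaussian tail. -/

/-! ### Parent maps and the deletion of a vertex -/

section ParentMaps

variable {V R : Type*}

/-- Following the parent map `p` from the first vertex, the last vertex visited is the second one,
and it is attached to the given label. -/
inductive EndsAt (p : V → V ⊕ R) : V → V → R → Prop
  | last {v : V} {r : R} (h : p v = Sum.inr r) : EndsAt p v v r
  | step {v v' u : V} {r : R} (h : p v = Sum.inl v') (h' : EndsAt p v' u r) : EndsAt p v u r

/-- A parent map is terminating if every vertex is eventually led to a label. -/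
def IsTerminating (p : V → V ⊕ R) : Prop := ∀ v, ∃ u r, EndsAt p v u r

namespace EndsAt

variable {p : V → V ⊕ R} {u v v' u' : V} {r r' : R}

theorem step_iff (h : p v = Sum.inl v') : EndsAt p v u r ↔ EndsAt p v' u r := by
  refine ⟨fun H => ?_, .step h⟩
  cases H with
  | last h' => simp [h] at h'
  | step h' H => rw [h] at h'; cases h'; exact H

theorem last_iff (h : p v = Sum.inr r') : EndsAt p v u r ↔ u = v ∧ r = r' := by
  constructor
  · intro H
    cases H with
    | last h' => rw [h] at h'; cases h'; exact ⟨rfl, rfl⟩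
    | step h' H => simp [h] at h'
  · rintro ⟨rfl, rfl⟩; exact .last h

theorem apply_last (H : EndsAt p v u r) : p u = Sum.inr r := by
  induction H with
  | last h => exact h
  | step _ _ ih => exact ih

theorem unique (H : EndsAt p v u r) (H' : EndsAt p v u' r') : u = u' ∧ r = r' := by
  induction H with
  | last h => rw [last_iff h] at H'; exact ⟨H'.1.symm, H'.2.symm⟩
  | step h _ ih => rw [step_iff h] at H'; exact ih H'

end EndsAt

open Classical in
/-- The parent map on `V` with value `z` at `x` and otherwise given by a parent map on the
complement of `x`, in which the additional label `none` stands for `x`. -/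
noncomputable def graft (x : V) (z : V ⊕ R) (p : {v // v ≠ x} → {v // v ≠ x} ⊕ Option R) :
    V → V ⊕ R := fun v =>
  if h : v = x then z
  else Sum.elim (fun v => Sum.inl v.1) (fun o => o.elim (Sum.inl x) Sum.inr) (p ⟨v, h⟩)

section Graft

variable {x : V} {z : V ⊕ R} {p : {v // v ≠ x} → {v // v ≠ x} ⊕ Option R}

@[simp] theorem graft_self : graft x z p x = z := by simp [graft]

theorem graft_apply (v : {v // v ≠ x}) : graft x z p v =
    Sum.elim (fun v => Sum.inl v.1) (fun o => o.elim (Sum.inl x) Sum.inr) (p v) := by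
  simp [graft, v.2]

theorem graft_bijective (x : V) : Function.Bijective
    (fun a : (V ⊕ R) × ({v // v ≠ x} → {v // v ≠ x} ⊕ Option R) => graft x a.1 a.2) := by
  constructor
  · rintro ⟨z, p⟩ ⟨z', p'⟩ h
    simp only at h
    have hz : z = z' := by simpa using congrFun h x
    refine Prod.ext hz (funext fun v => ?_)
    have hv := congrFun h v.1
    rw [graft_apply, graft_apply] at hv
    have := v.2
    rcases hp : p v with ⟨a, ha⟩ | _ | a <;> rcases hp' : p' v with ⟨b, hb⟩ | _ | b <;>
      simp_all [eq_comm (a := x)]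
  · intro p
    classical
    refine ⟨(p x, fun v => Sum.elim
      (fun u => if h : u = x then Sum.inr none else Sum.inl ⟨u, h⟩) (fun r => Sum.inr (some r))
      (p v.1)), funext fun v => ?_⟩
    by_cases h : v = x
    · subst h; simp
    · have := graft_apply (z := p x) (p := fun v : {v // v ≠ x} => Sum.elim
        (fun u => if h : u = x then Sum.inr none else Sum.inl ⟨u, h⟩)
        (fun r => Sum.inr (some r)) (p v.1)) ⟨v, h⟩
      simp only at this ⊢
      rw [this]
      rcases hp : p v with a | a
      · by_cases ha : a = x <;> simp [ha]
      · simp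

theorem EndsAt.graft_some {v u : {v // v ≠ x}} {o : Option R} (H : EndsAt p v u o) {r : R}
    (ho : o = some r) : EndsAt (graft x z p) v u r := by
  induction H with
  | last h => exact .last (by simp [graft_apply, h, ho])
  | step h _ ih => exact .step (by rw [graft_apply, h]; rfl) (ih ho)

theorem EndsAt.graft_none {v u : {v // v ≠ x}} {o : Option R} (H : EndsAt p v u o)
    (ho : o = none) {u' : V} {r : R} (hx : EndsAt (graft x z p) x u' r) :
    EndsAt (graft x z p) v u' r := by
  induction H with
  | last h => exact .step (v' := x) (by simp [graft_apply, h, ho]) hx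
  | step h _ ih => exact .step (by rw [graft_apply, h]; rfl) (ih ho)

/-- A path avoiding `x` is a path of `p`; one that meets `x` reaches the label `none` in `p` and
continues as the path of `x`. -/
theorem EndsAt.of_graft {v u : V} {r : R} (H : EndsAt (graft x z p) v u r) (hv : v ≠ x) :
    (∃ hu, EndsAt p ⟨v, hv⟩ ⟨u, hu⟩ (some r)) ∨
      (∃ u', EndsAt p ⟨v, hv⟩ u' none) ∧ EndsAt (graft x z p) x u r := by
  induction H with
  | @last v r h =>
    refine .inl ⟨hv, .last ?_⟩
    have := graft_apply (z := z) (p := p) ⟨v, hv⟩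
    rcases hp : p ⟨v, hv⟩ with a | _ | a <;> simp_all
  | @step v v' u r h H ih =>
    have := graft_apply (z := z) (p := p) ⟨v, hv⟩
    rcases hp : p ⟨v, hv⟩ with a | _ | a
    · simp only [hp, h, Sum.elim_inl, Sum.inl.injEq] at this
      subst this
      simpa only [EndsAt.step_iff hp] using ih a.2
    · simp only [hp, h, Sum.elim_inr, Option.elim_none, Sum.inl.injEq] at this
      subst this
      exact .inr ⟨⟨_, .last hp⟩, H⟩
    · simp [hp, h] at this

theorem IsTerminating.of_graft (H : IsTerminating (graft x z p)) : IsTerminating p := by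
  intro v
  obtain ⟨u, r, h⟩ := H v
  rcases h.of_graft v.2 with ⟨hu, h⟩ | ⟨⟨u', h⟩, -⟩
  exacts [⟨_, _, h⟩, ⟨_, _, h⟩]

theorem IsTerminating.graft (H : IsTerminating p) {u : V} {r : R}
    (hx : EndsAt (graft x z p) x u r) : IsTerminating (graft x z p) := by
  intro v
  by_cases hv : v = x
  · subst hv; exact ⟨_, _, hx⟩
  · obtain ⟨u', o, h⟩ := H ⟨v, hv⟩
    cases o with
    | none => exact ⟨_, _, h.graft_none rfl hx⟩
    | some r' => exact ⟨_, _, h.graft_some rfl⟩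

/-- Attaching `x` to a vertex that leads back to `x` closes a cycle, and a path that ends cannot run
into it. -/
theorem EndsAt.not_none_of_graft {w u' : {v // v ≠ x}} (hw : EndsAt p w u' none) {v u : V} {r : R}
    (H : EndsAt (graft x (Sum.inl w.1) p) v u r) :
    v ≠ x ∧ ∀ h : v ≠ x, ¬ ∃ u', EndsAt p ⟨v, h⟩ u' none := by
  induction H with
  | @last v r h =>
    have hv : v ≠ x := by rintro rfl; simp at h
    refine ⟨hv, fun _ ⟨u'', h''⟩ => ?_⟩
    have := graft_apply (z := Sum.inl w.1) (p := p) ⟨v, hv⟩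
    rcases hp : p ⟨v, hv⟩ with a | _ | a
    · simp [hp, h] at this
    · simp [hp, h] at this
    · simp [EndsAt.last_iff hp] at h''
  | @step v v' u r h H ih =>
    have hv : v ≠ x := by
      rintro rfl
      simp only [graft_self, Sum.inl.injEq] at h
      subst h
      exact ih.2 w.2 ⟨_, hw⟩
    refine ⟨hv, fun _ ⟨u'', h''⟩ => ?_⟩
    have := graft_apply (z := Sum.inl w.1) (p := p) ⟨v, hv⟩
    rcases hp : p ⟨v, hv⟩ with a | _ | a
    · simp only [hp, h, Sum.elim_inl, Sum.inl.injEq] at this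
      subst this
      exact ih.2 a.2 ⟨_, (EndsAt.step_iff hp).1 h''⟩
    · simp only [hp, h, Sum.elim_inr, Option.elim_none, Sum.inl.injEq] at this
      exact ih.1 this
    · simp [hp, h] at this

theorem endsAt_graft_inl {w : {v // v ≠ x}} {u : V} {r : R} :
    EndsAt (graft x (Sum.inl w.1) p) x u r ↔ ∃ hu, EndsAt p w ⟨u, hu⟩ (some r) := by
  constructor
  · intro H
    have H' := (EndsAt.step_iff graft_self).1 H
    rcases H'.of_graft w.2 with h | ⟨⟨u', h⟩, -⟩
    · exact h
    · exact absurd rfl (h.not_none_of_graft H).1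
  · rintro ⟨hu, h⟩
    exact .step graft_self (h.graft_some rfl)

theorem not_endsAt_graft_inl_self {v u : V} {r : R}
    (H : EndsAt (graft x (Sum.inl x) p) v u r) : v ≠ x := by
  induction H with
  | last h => rintro rfl; simp at h
  | step h _ ih => rintro rfl; simp at h; exact ih h.symm

theorem endsAt_graft_inr {r₀ : R} {u : V} {r : R} :
    EndsAt (graft x (Sum.inr r₀) p) x u r ↔ u = x ∧ r = r₀ :=
  EndsAt.last_iff graft_self

end Graft

/-- The terminating parent maps for which `y` is led to the label `r`. -/
def LeadsTo (y : V) (r : R) (p : V → V ⊕ R) : Prop := IsTerminating p ∧ ∃ u, EndsAt p y u r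

/-- The terminating parent maps for which `x` and `y` are led to the label `r` through different
last vertices. -/
def LeadApart (x y : V) (r : R) (p : V → V ⊕ R) : Prop :=
  IsTerminating p ∧ ∃ u u', u ≠ u' ∧ EndsAt p x u r ∧ EndsAt p y u' r

section Events

variable {x : V} {p : {v // v ≠ x} → {v // v ≠ x} ⊕ Option R} {r : R}

theorem leadsTo_graft_inr {r₀ : R} :
    LeadsTo x r (graft x (Sum.inr r₀) p) ↔ r₀ = r ∧ IsTerminating p := by
  constructor
  · rintro ⟨h, u, hu⟩
    exact ⟨(endsAt_graft_inr.1 hu).2.symm, h.of_graft⟩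
  · rintro ⟨rfl, h⟩
    have := (endsAt_graft_inr (p := p) (r₀ := r₀)).2 ⟨rfl, rfl⟩
    exact ⟨h.graft this, _, this⟩

theorem not_leadsTo_graft_inl_self : ¬ LeadsTo x r (graft x (Sum.inl x) p) := by
  rintro ⟨-, u, hu⟩
  exact not_endsAt_graft_inl_self hu rfl

theorem leadsTo_graft_inl {w : {v // v ≠ x}} :
    LeadsTo x r (graft x (Sum.inl w.1) p) ↔ LeadsTo w (some r) p := by
  constructor
  · rintro ⟨h, u, hu⟩
    obtain ⟨hu', H⟩ := endsAt_graft_inl.1 hu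
    exact ⟨h.of_graft, _, H⟩
  · rintro ⟨h, u, hu⟩
    have := endsAt_graft_inl.2 ⟨u.2, hu⟩
    exact ⟨h.graft this, _, this⟩

/-- Here `x` is its own last vertex; were `y` led to `none`, it would pass through `x` and end there
too. -/
theorem leadApart_graft_inr {y : {v // v ≠ x}} {r₀ : R} :
    LeadApart x y.1 r (graft x (Sum.inr r₀) p) ↔ r₀ = r ∧ LeadsTo y (some r) p := by
  constructor
  · rintro ⟨h, u, u', huu, hu, hu'⟩
    obtain ⟨rfl, rfl⟩ := endsAt_graft_inr.1 hu
    refine ⟨rfl, h.of_graft, ?_⟩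
    rcases hu'.of_graft y.2 with ⟨hx, H⟩ | ⟨-, H⟩
    · exact ⟨_, H⟩
    · exact absurd (endsAt_graft_inr.1 H).1.symm huu
  · rintro ⟨rfl, h, u, hu⟩
    have := (endsAt_graft_inr (p := p) (r₀ := r₀)).2 ⟨rfl, rfl⟩
    exact ⟨h.graft this, x, u, u.2.symm, this, hu.graft_some rfl⟩

theorem not_leadApart_graft_inl_self {y : V} : ¬ LeadApart x y r (graft x (Sum.inl x) p) := by
  rintro ⟨-, u, u', -, hu, -⟩
  exact not_endsAt_graft_inl_self hu rfl

/-- The path of `w` cannot return to `x`, and that of `y` cannot meet `x` without sharing its last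
vertex; both therefore live in `p`. -/
theorem leadApart_graft_inl {y w : {v // v ≠ x}} :
    LeadApart x y.1 r (graft x (Sum.inl w.1) p) ↔ LeadApart w y (some r) p := by
  constructor
  · rintro ⟨h, u, u', huu, hu, hu'⟩
    obtain ⟨hux, H⟩ := endsAt_graft_inl.1 hu
    rcases hu'.of_graft y.2 with ⟨hx, H'⟩ | ⟨-, H'⟩
    · exact ⟨h.of_graft, _, _, fun e => huu (congrArg Subtype.val e), H, H'⟩
    · exact absurd (hu.unique H').1 huu
  · rintro ⟨h, u, u', huu, hu, hu'⟩
    have := endsAt_graft_inl.2 ⟨u.2, hu⟩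
    exact ⟨h.graft this, u, u', fun e => huu (Subtype.ext e), this, hu'.graft_some rfl⟩

theorem not_leadApart_self {y : V} {r : R} {p : V → V ⊕ R} : ¬ LeadApart y y r p := by
  rintro ⟨-, u, u', h, hu, hu'⟩
  exact h (hu.unique hu').1

end Events

/-! ### Weighted sums over parent maps and their recursions -/

section Sums

/-- The weight of a parent map: `c r` for each vertex attached to the label `r`, and `w` for each
vertex attached to another vertex. -/
def mapWeight [Fintype V] (w : ℝ) (c : R → ℝ) (p : V → V ⊕ R) : ℝ :=
  ∏ v, Sum.elim (fun _ => w) c (p v)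

theorem mapWeight_graft [Fintype V] [DecidableEq V] (w : ℝ) (c : R → ℝ) (x : V) (z : V ⊕ R)
    (p : {v // v ≠ x} → {v // v ≠ x} ⊕ Option R) :
    mapWeight w c (graft x z p) =
      Sum.elim (fun _ => w) c z * mapWeight w (fun o => o.elim w c) p := by
  rw [mapWeight, Fintype.prod_eq_mul_prod_subtype_ne _ x, graft_self, mapWeight]
  congr 1
  refine Finset.prod_congr rfl fun v _ => ?_
  rw [graft_apply]
  rcases p v with a | _ | a <;> simp

open Classical in
/-- The total weight of the parent maps that satisfy `P`. -/
noncomputable def mapSum [Fintype V] [DecidableEq V] [Fintype R] (w : ℝ) (c : R → ℝ)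
    (P : (V → V ⊕ R) → Prop) : ℝ := ∑ p, if P p then mapWeight w c p else 0

variable [Fintype V] [DecidableEq V] [Fintype R]

theorem mapSum_congr {w : ℝ} {c : R → ℝ} {P Q : (V → V ⊕ R) → Prop} (h : ∀ p, P p ↔ Q p) :
    mapSum w c P = mapSum w c Q := by
  rw [funext fun p => propext (h p)]

theorem mapSum_false (w : ℝ) (c : R → ℝ) : mapSum w c (fun _ : V → V ⊕ R => False) = 0 := by
  simp [mapSum]

open Classical in
theorem mapSum_and_left (w : ℝ) (c : R → ℝ) (a : Prop) (P : (V → V ⊕ R) → Prop) :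
    mapSum w c (fun p => a ∧ P p) = if a then mapSum w c P else 0 := by
  by_cases h : a <;> simp [h, mapSum]

/-- Conditioning on the value at `x`: a loop, another vertex, or a label. After deletion `none` has
weight `w`, the cost of being attached to `x`. -/
theorem mapSum_eq_sum_graft (w : ℝ) (c : R → ℝ) (x : V)
    (P : (V → V ⊕ R) → Prop) :
    mapSum w c P =
      w * mapSum w (fun o => o.elim w c) (fun p => P (graft x (Sum.inl x) p)) +
      ∑ v : {v // v ≠ x},
        w * mapSum w (fun o => o.elim w c) (fun p => P (graft x (Sum.inl v.1) p)) +
      ∑ r, c r * mapSum w (fun o => o.elim w c) (fun p => P (graft x (Sum.inr r) p)) := by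
  classical
  rw [mapSum, ← (graft_bijective x).sum_comp, Fintype.sum_prod_type, Fintype.sum_sum_type,
    Fintype.sum_eq_add_sum_subtype_ne _ x]
  simp only [mapSum, mapWeight_graft, mul_sum, mul_ite, mul_zero, Sum.elim_inl, Sum.elim_inr]

theorem mapSum_isTerminating [Nonempty V] (w : ℝ) (c : R → ℝ) (y : V) :
    mapSum w c (IsTerminating : (V → V ⊕ R) → Prop) = ∑ r, mapSum w c (LeadsTo y r) := by
  classical
  simp only [mapSum]
  rw [Finset.sum_comm]
  refine Finset.sum_congr rfl fun p _ => ?_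
  by_cases h : IsTerminating p
  · obtain ⟨u, r, hr⟩ := h y
    rw [if_pos h, Finset.sum_eq_single r]
    · rw [if_pos ⟨h, u, hr⟩]
    · rintro r' - hr'
      rw [if_neg]
      rintro ⟨-, u', H⟩
      exact hr' (H.unique hr).2
    · simp
  · rw [if_neg h, Finset.sum_eq_zero]
    intro r _
    exact if_neg fun H => h H.1

theorem mapSum_isTerminating_of_isEmpty [IsEmpty V] (w : ℝ) (c : R → ℝ) :
    mapSum w c (IsTerminating : (V → V ⊕ R) → Prop) = 1 := by
  classical
  have h : ∀ p : V → V ⊕ R, IsTerminating p := fun p v => isEmptyElim v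
  simp [mapSum, h, mapWeight]

theorem mapSum_leadsTo_rec (w : ℝ) (c : R → ℝ) (x : V) (r : R) :
    mapSum w c (LeadsTo x r) =
      ∑ v : {v // v ≠ x}, w * mapSum w (fun o => o.elim w c) (LeadsTo v (some r)) +
      c r * mapSum w (fun o => o.elim w c)
        (IsTerminating : ({v // v ≠ x} → {v // v ≠ x} ⊕ Option R) → Prop) := by
  classical
  rw [mapSum_eq_sum_graft w c x]
  simp only [leadsTo_graft_inl, leadsTo_graft_inr, not_leadsTo_graft_inl_self, mapSum_false,
    mapSum_and_left]
  simp

theorem mapSum_leadApart_rec (w : ℝ) (c : R → ℝ) (x : V) (y : {v // v ≠ x})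
    (r : R) :
    mapSum w c (LeadApart x y.1 r) =
      ∑ v : {v // v ≠ x}, w * mapSum w (fun o => o.elim w c) (LeadApart v y (some r)) +
      c r * mapSum w (fun o => o.elim w c) (LeadsTo y (some r)) := by
  classical
  rw [mapSum_eq_sum_graft w c x]
  simp only [leadApart_graft_inl, leadApart_graft_inr, not_leadApart_graft_inl_self, mapSum_false,
    mapSum_and_left]
  simp

end Sums

end ParentMaps

/-- A weighted form of Cayley's formula: the forests in which a given vertex is led to `r`. -/
theorem mapSum_leadsTo (n : ℕ) : ∀ {V R : Type} [Fintype V] [DecidableEq V] [Fintype R]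
    (w : ℝ) (c : R → ℝ) (y : V) (r : R), Fintype.card V = n + 1 →
    mapSum w c (LeadsTo y r) = c r * ((∑ r, c r) + (n + 1) * w) ^ n := by
  induction n with
  | zero =>
    intro V R _ _ _ w c y r hV
    have hW : Fintype.card {v // v ≠ y} = 0 := by simp [hV]
    have := Fintype.card_eq_zero_iff.1 hW
    rw [mapSum_leadsTo_rec, mapSum_isTerminating_of_isEmpty]
    simp
  | succ n ih =>
    intro V R _ _ _ w c y r hV
    have hW : Fintype.card {v // v ≠ y} = n + 1 := by simp [hV]
    have : Nonempty {v // v ≠ y} := Fintype.card_pos_iff.1 (by omega)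
    -- The `n + 1` possible parents contribute `(n + 1) w`, the label case `w + ∑ c`; together they
    -- supply one more factor of the invariant total.
    rw [mapSum_leadsTo_rec, mapSum_isTerminating _ _ this.some]
    simp only [ih _ _ _ _ hW, Option.elim_some, ← Finset.sum_mul, Finset.sum_const, card_univ, hW,
      Fintype.sum_option, Option.elim_none]
    push_cast
    rw [nsmul_eq_mul]
    push_cast
    ring

theorem mapSum_isTerminating_eq {V R : Type} [Fintype V] [DecidableEq V] [Fintype R]
    (w : ℝ) (c : R → ℝ) {n : ℕ} (hV : Fintype.card V = n + 1) :
    mapSum w c (IsTerminating : (V → V ⊕ R) → Prop) =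
      (∑ r, c r) * ((∑ r, c r) + (n + 1) * w) ^ n := by
  have : Nonempty V := Fintype.card_pos_iff.1 (by omega)
  rw [mapSum_isTerminating _ _ this.some]
  simp only [mapSum_leadsTo n _ _ _ _ hV, ← Finset.sum_mul]

/-- The index `i` counts the vertices after `x` on its path to `r`. That path contributes `c r * w ^
i`, and leading `y` to `r` among the `m + 1 - i` remaining vertices contributes `c r * T ^ (m - i)`.
-/
theorem mapSum_leadApart (m : ℕ) : ∀ {V R : Type} [Fintype V] [DecidableEq V] [Fintype R]
    (w : ℝ) (c : R → ℝ) (x y : V) (r : R), x ≠ y → Fintype.card V = m + 2 →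
    mapSum w c (LeadApart x y r) = c r ^ 2 * ∑ i ∈ range (m + 1),
      w ^ i * (m.descFactorial i : ℝ) * ((∑ r, c r) + (m + 2) * w) ^ (m - i) := by
  induction m with
  | zero =>
    intro V R _ _ _ w c x y r hxy hV
    have hW : Fintype.card {v // v ≠ x} = 0 + 1 := by simp [hV]
    have hsub : Subsingleton {v // v ≠ x} := Fintype.card_le_one_iff_subsingleton.1 (by omega)
    have hv : ∀ v : {v // v ≠ x}, v = ⟨y, hxy.symm⟩ := fun v => Subsingleton.elim _ _
    rw [mapSum_leadApart_rec w c x ⟨y, hxy.symm⟩, mapSum_leadsTo 0 _ _ _ _ hW]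
    have h0 : ∀ v : {v // v ≠ x}, mapSum w (fun o : Option R => o.elim w c)
        (LeadApart v ⟨y, hxy.symm⟩ (some r)) = 0 := by
      intro v
      rw [hv v, mapSum_congr (Q := fun _ => False) fun p => by simp [not_leadApart_self],
        mapSum_false]
    simp [h0, sq]
  | succ m ih =>
    intro V R _ _ _ w c x y r hxy hV
    have hW : Fintype.card {v // v ≠ x} = m + 2 := by simp [hV]
    have hW' : Fintype.card {v : {v // v ≠ x} // v ≠ ⟨y, hxy.symm⟩} = m + 1 := by
      rw [Fintype.card_subtype_compl, hW]; simp
    rw [mapSum_leadApart_rec w c x ⟨y, hxy.symm⟩, mapSum_leadsTo (m + 1) _ _ _ _ hW,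
      -- The parent `y` of `x` contributes nothing; the other `m + 1` parents give equal terms,
      -- whence the falling factorial.
      Fintype.sum_eq_add_sum_subtype_ne _ (⟨y, hxy.symm⟩ : {v // v ≠ x}),
      mapSum_congr (P := LeadApart (⟨y, hxy.symm⟩ : {v // v ≠ x}) _ _) (Q := fun _ => False)
        fun p => by simp [not_leadApart_self],
      mapSum_false,
      Finset.sum_congr rfl fun v _ => by rw [ih _ _ _ _ _ v.2 hW], Finset.sum_const, card_univ,
      hW', sum_range_succ' _ (m + 1)]
    simp only [Option.elim_some, Fintype.sum_option, Option.elim_none, Nat.succ_descFactorial_succ,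
      Nat.add_sub_add_right, Nat.descFactorial_zero, nsmul_eq_mul, pow_succ]
    push_cast
    have hT : w + ∑ r, c r + (m + 2) * w = (∑ r, c r) + (m + 1 + 2) * w := by ring
    have hT' : w + ∑ r, c r + (m + 1 + 1) * w = (∑ r, c r) + (m + 1 + 2) * w := by ring
    rw [hT, hT']
    simp only [mul_add, mul_sum, pow_succ]
    rw [mul_zero, zero_add]
    congr 1
    · exact Finset.sum_congr rfl fun i _ => by ring
    · ring_nf

/-! ### Rooted forests as terminating parent maps -/

section Bridge

variable {V R : Type*}

/-- The graph in which every vertex is joined to its parent. -/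
def parentGraph (p : V → V ⊕ R) : SimpleGraph V := SimpleGraph.fromRel fun u v => p u = Sum.inl v

namespace EndsAt

variable {p : V → V ⊕ R} {u v v' : V} {r : R}

theorem apply_ne_self (H : EndsAt p v u r) : p v ≠ Sum.inl v := by
  induction H with
  | last h => simp [h]
  | step h _ ih =>
    intro h'
    rw [h] at h'
    cases h'
    exact ih h

theorem apply_apply_ne (H : EndsAt p v u r) (h : p v = Sum.inl v') : p v' ≠ Sum.inl v := by
  induction H generalizing v' with
  | last h' => simp [h] at h'
  | step h' _ ih =>
    rw [h'] at h
    cases h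
    exact fun h => ih h h'

theorem iff_of_adj (h : (parentGraph p).Adj v v') : EndsAt p v u r ↔ EndsAt p v' u r := by
  rcases h.2 with h | h
  · exact step_iff h
  · exact (step_iff h).symm

theorem iff_of_reachable (h : (parentGraph p).Reachable v v') :
    EndsAt p v u r ↔ EndsAt p v' u r := by
  obtain ⟨q⟩ := h
  induction q with
  | nil => rfl
  | cons h _ ih => exact (iff_of_adj h).trans ih

theorem reachable (H : EndsAt p v u r) : (parentGraph p).Reachable v u := by
  induction H with
  | last => exact .refl _
  | step h H ih =>
    refine SimpleGraph.Reachable.trans (SimpleGraph.Adj.reachable ⟨?_, .inl h⟩) ih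
    rintro rfl
    exact (EndsAt.step h H).apply_ne_self h

/-- If `w` still leads to `v` after the redirection, then `v` and `w` lie on a cycle of `p`, which
no path ending under `p` can enter. -/
theorem not_endsAt_update [DecidableEq V] {w z : V} {r₀ : R} (hv : p v = Sum.inl w)
    (hw : EndsAt (Function.update p v (Sum.inr r₀)) w v r₀) (H : EndsAt p u z r) :
    ¬ EndsAt (Function.update p v (Sum.inr r₀)) u v r₀ := by
  induction H with
  | @last u r h =>
    have huv : u ≠ v := by rintro rfl; simp [hv] at h
    rw [EndsAt.last_iff (r' := r) (by rw [Function.update_of_ne huv, h])]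
    exact fun h => huv h.1.symm
  | @step u u' _ _ h _ ih =>
    by_cases huv : u = v
    · subst huv
      rw [hv] at h
      cases h
      exact absurd hw ih
    · rwa [EndsAt.step_iff (v' := u') (by rw [Function.update_of_ne huv, h])]

end EndsAt

theorem IsTerminating.adj_iff {p : V → V ⊕ R} (hp : IsTerminating p) {u v : V} :
    (parentGraph p).Adj u v ↔ p u = Sum.inl v ∨ p v = Sum.inl u := by
  refine ⟨fun h => h.2, fun h => ⟨?_, h⟩⟩
  rintro rfl
  obtain ⟨_, _, H⟩ := hp u
  exact H.apply_ne_self (by simpa using h)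

/-- Redirect `v` to a label. Ending at `v` is then invariant along all edges but `s(v, w)`, so if
`w` stayed connected to `v` it would lead to `v`, and `p` would have a cycle. -/
theorem IsTerminating.isBridge {p : V → V ⊕ R} (hp : IsTerminating p) {v w : V}
    (h : p v = Sum.inl w) : (parentGraph p).IsBridge s(v, w) := by
  classical
  -- Any label would serve for the redirection; the path of `w` provides one.
  obtain ⟨z, r₀, hw⟩ := hp w
  rw [SimpleGraph.isBridge_iff]
  intro hr
  have key : ∀ {a b u : V} {r : R}, p a = Sum.inl b → s(a, b) ≠ s(v, w) →
      (EndsAt (Function.update p v (Sum.inr r₀)) a u r ↔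
        EndsAt (Function.update p v (Sum.inr r₀)) b u r) := by
    intro a b u r hab hne
    refine EndsAt.step_iff ?_
    rw [Function.update_of_ne, hab]
    rintro rfl
    rw [h] at hab
    cases hab
    exact hne rfl
  have hreach : ∀ {a b : V}, ((parentGraph p).deleteEdges {s(v, w)}).Reachable a b →
      (EndsAt (Function.update p v (Sum.inr r₀)) a v r₀ ↔
        EndsAt (Function.update p v (Sum.inr r₀)) b v r₀) := by
    rintro a b ⟨q⟩
    induction q with
    | nil => rfl
    | @cons a b _ hab _ ih =>
      refine Iff.trans ?_ ih
      rw [SimpleGraph.deleteEdges_adj, Set.mem_singleton_iff] at hab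
      rcases hab.1.2 with h' | h'
      · exact key h' hab.2
      · exact (key h' (by rw [Sym2.eq_swap]; exact hab.2)).symm
  have hvv : EndsAt (Function.update p v (Sum.inr r₀)) v v r₀ := .last (by simp)
  have hwv := (hreach hr).1 hvv
  exact EndsAt.not_endsAt_update h hwv hw hwv

theorem IsTerminating.isAcyclic {p : V → V ⊕ R} (hp : IsTerminating p) :
    (parentGraph p).IsAcyclic := by
  rw [SimpleGraph.isAcyclic_iff_forall_adj_isBridge]
  intro v w h
  rcases h.2 with h | h
  · exact hp.isBridge h
  · rw [Sym2.eq_swap]; exact hp.isBridge h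

/-- Both neighbours are second vertices of geodesics from `u` to `r`, and an acyclic graph has only
one such path. -/
theorem SimpleGraph.IsAcyclic.eq_of_adj_of_dist_eq {G : SimpleGraph V} (hG : G.IsAcyclic)
    {u v v' r : V} (hv : G.Adj u v) (hv' : G.Adj u v') (hr : G.Reachable u r)
    (h : G.dist u r = G.dist v r + 1) (h' : G.dist u r = G.dist v' r + 1) : v = v' := by
  obtain ⟨a, ha⟩ := (hv.symm.reachable.trans hr).exists_walk_length_eq_dist
  obtain ⟨b, hb⟩ := (hv'.symm.reachable.trans hr).exists_walk_length_eq_dist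
  have hpa := (SimpleGraph.Walk.cons hv a).isPath_of_length_eq_dist (by simp [ha, h])
  have hpb := (SimpleGraph.Walk.cons hv' b).isPath_of_length_eq_dist (by simp [hb, h'])
  have := congrArg Subtype.val ((hG.subsingleton_path u r).elim ⟨_, hpa⟩ ⟨_, hpb⟩)
  simpa using congrArg SimpleGraph.Walk.snd this

theorem SimpleGraph.Reachable.exists_adj_dist_eq {G : SimpleGraph V} {v r : V}
    (h : G.Reachable v r) (hne : v ≠ r) : ∃ u, G.Adj v u ∧ G.dist v r = G.dist u r + 1 := by
  obtain ⟨a, ha⟩ := h.exists_walk_length_eq_dist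
  cases a with
  | nil => exact absurd rfl hne
  | @cons _ u _ hu q =>
    refine ⟨u, hu, le_antisymm ?_ ?_⟩
    · obtain ⟨b, hb⟩ := (q.reachable).exists_walk_length_eq_dist
      rw [← hb]
      exact SimpleGraph.dist_le (SimpleGraph.Walk.cons hu b)
    · rw [← ha, SimpleGraph.Walk.length_cons]
      exact Nat.succ_le_succ (SimpleGraph.dist_le q)

variable [Fintype V]

open Classical in
/-- The rooted forest of a terminating parent map: the roots are the vertices without parent. -/
noncomputable def parentForest (p : {p : V → V ⊕ Unit // IsTerminating p}) :
    RootedForest (⊤ : SimpleGraph V) where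
  graph := parentGraph p.1
  le_graph := le_top
  acyclic := p.2.isAcyclic
  roots := {v | p.1 v = Sum.inr ()}
  existsUnique_root v := by
    obtain ⟨u, r, H⟩ := p.2 v
    refine ⟨u, ⟨by simpa using H.apply_last, H.reachable⟩, fun u' ⟨hu', h⟩ => ?_⟩
    have hu' : EndsAt p.1 u' u' () := .last (by simpa using hu')
    exact (((EndsAt.iff_of_reachable h).2 hu').unique H).1

theorem mem_roots_parentForest {p : {p : V → V ⊕ Unit // IsTerminating p}} {v : V} :
    v ∈ (parentForest p).roots ↔ p.1 v = Sum.inr () := by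
  simp [parentForest]

/-- Induction along the path to the root: the roots agree, and an edge oriented oppositely by the
two maps would, by induction, form a two-cycle. -/
theorem parentForest_injective : Function.Injective (parentForest (V := V)) := by
  intro p p' h
  refine Subtype.ext (funext fun v => ?_)
  have hroots : ∀ v, p.1 v = Sum.inr () ↔ p'.1 v = Sum.inr () := fun v => by
    rw [← mem_roots_parentForest, h, mem_roots_parentForest]
  have hadj : ∀ u v, (parentGraph p.1).Adj u v ↔ (parentGraph p'.1).Adj u v := fun u v => by
    have : parentGraph p.1 = parentGraph p'.1 := congrArg RootedForest.graph h
    rw [this]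
  obtain ⟨u, r, H⟩ := p.2 v
  induction H with
  | last h => rw [h, eq_comm]; exact (hroots _).1 h
  | @step v v' u r hv H ih =>
    rcases p'.2.adj_iff.1 ((hadj v v').1 (p.2.adj_iff.2 (.inl hv))) with h' | h'
    · rw [hv, h']
    · exact absurd (ih.trans h') ((EndsAt.step hv H).apply_apply_ne hv)

/-- The parent of a non-root is a neighbour one step closer to the root. The distance to the root
decreases, so the map terminates; it changes by one along each edge of a tree, so every edge is a
parent edge. -/
theorem parentForest_surjective : Function.Surjective (parentForest (V := V)) := by
  classical
  intro F
  choose ρ hρ hρu using F.existsUnique_root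
  have hadj : ∀ {u v}, F.graph.Adj u v → ρ u = ρ v := fun {u v} h =>
    hρu v (ρ u) ⟨(hρ u).1, h.symm.reachable.trans (hρ u).2⟩
  have hroot : ∀ {v}, v ∈ F.roots → ρ v = v := fun {v} h => (hρu v v ⟨h, .refl _⟩).symm
  have hex : ∀ v, v ∉ F.roots →
      ∃ u, F.graph.Adj v u ∧ F.graph.dist v (ρ v) = F.graph.dist u (ρ v) + 1 := fun v hv =>
    (hρ v).2.exists_adj_dist_eq fun h => hv (by rw [h]; exact (hρ v).1)
  choose f hf using hex
  let p : V → V ⊕ Unit := fun v => if h : v ∈ F.roots then Sum.inr () else Sum.inl (f v h)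
  have hp_inr : ∀ {v}, p v = Sum.inr () ↔ v ∈ F.roots := fun {v} => by
    by_cases h : v ∈ F.roots <;> simp [p, h]
  have hp_inl : ∀ {v} (h : v ∉ F.roots), p v = Sum.inl (f v h) := fun {v} h => by simp [p, h]
  have hp : IsTerminating p := by
    intro v
    induction hn : F.graph.dist v (ρ v) generalizing v with
    | zero =>
      have : v ∈ F.roots := by
        by_contra h
        have := (hf v h).2
        omega
      exact ⟨v, (), .last (hp_inr.2 this)⟩
    | succ n ih =>
      have : v ∉ F.roots := fun h => by simp [hroot h] at hn
      obtain ⟨h1, h2⟩ := hf v this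
      obtain ⟨u, r, H⟩ := ih (f v this) (by rw [← hadj h1]; omega)
      exact ⟨u, r, .step (hp_inl this) H⟩
  have hstep : ∀ {u v}, F.graph.Adj u v →
      F.graph.dist u (ρ u) = F.graph.dist v (ρ u) + 1 → p u = Sum.inl v := by
    intro u v h hd
    have hu : u ∉ F.roots := fun h => by simp [hroot h] at hd
    obtain ⟨h1, h2⟩ := hf u hu
    rw [hp_inl hu, F.acyclic.eq_of_adj_of_dist_eq h1 h (hρ u).2 h2 hd]
  refine ⟨⟨p, hp⟩, RootedForest.ext ?_ ?_⟩
  · ext u v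
    change (parentGraph p).Adj u v ↔ _
    rw [hp.adj_iff]
    constructor
    · have : ∀ {u v}, p u = Sum.inl v → F.graph.Adj u v := by
        intro u v h
        have hu : u ∉ F.roots := fun hu => by simp [hp_inr.2 hu] at h
        rw [hp_inl hu] at h
        cases h
        exact (hf u hu).1
      rintro (h | h)
      · exact this h
      · exact (this h).symm
    · intro h
      have := F.acyclic.dist_eq_dist_add_one_of_adj_of_reachable (u := ρ u) h
        (hρ u).2.symm
      rw [SimpleGraph.dist_comm (u := ρ u), SimpleGraph.dist_comm (u := ρ u)] at this
      rcases this with h' | h'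
      · exact .inl (hstep h h')
      · exact .inr (hstep h.symm (by rw [← hadj h]; exact h'))
  · ext v
    rw [mem_roots_parentForest, hp_inr]

theorem partition_part_eq_iff [DecidableEq V] {G : SimpleGraph V} (F : RootedForest G) (x y : V) :
    F.partition.part x = F.partition.part y ↔ F.graph.Reachable x y := by
  classical
  rw [← F.partition.mem_part_iff_part_eq_part (mem_univ _) (mem_univ _), RootedForest.partition]
  erw [Finpartition.mem_part_ofSetoid_iff_rel]
  exact ⟨fun h => h.symm, fun h => h.symm⟩

theorem card_parts_partition [DecidableEq V] {G : SimpleGraph V} (F : RootedForest G) :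
    F.partition.parts.card = F.roots.card := by
  symm
  refine Finset.card_bij (fun v _ => F.partition.part v)
    (fun v _ => F.partition.part_mem.2 (mem_univ v)) ?_ ?_
  · intro u hu v hv h
    rw [partition_part_eq_iff] at h
    obtain ⟨ρ, -, h'⟩ := F.existsUnique_root u
    exact (h' u ⟨hu, .refl _⟩).trans (h' v ⟨hv, h⟩).symm
  · intro b hb
    obtain ⟨v, hv⟩ := F.partition.nonempty_of_mem_parts hb
    obtain ⟨ρ, ⟨h1, h2⟩, -⟩ := F.existsUnique_root v
    refine ⟨ρ, h1, ?_⟩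
    rw [(partition_part_eq_iff F ρ v).2 h2.symm]
    exact F.partition.part_eq_of_mem hb hv

/-- Each non-root is matched with the edge to its parent; two vertices sharing an edge would form a
two-cycle. -/
theorem card_edgeFinset_parentGraph [DecidableEq V] {p : V → V ⊕ Unit} (hp : IsTerminating p)
    [Fintype (parentGraph p).edgeSet] :
    (parentGraph p).edgeFinset.card = #{v | ¬ p v = Sum.inr ()} := by
  symm
  refine Finset.card_bij
    -- The value `s(v, v)` is a dummy for roots, which are excluded.
    (fun v _ => Sum.elim (fun u => s(v, u)) (fun _ => s(v, v)) (p v)) ?_ ?_ ?_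
  · intro v hv
    rcases h : p v with u | u
    · simpa using hp.adj_iff.2 (.inl h)
    · simp [h] at hv
  · intro u hu v hv h
    rcases hu' : p u with u' | u'
    · rcases hv' : p v with v' | v'
      · simp only [hu', hv', Sum.elim_inl, Sym2.eq_iff] at h
        rcases h with h | ⟨rfl, rfl⟩
        · exact h.1
        · obtain ⟨_, _, H⟩ := hp u
          exact absurd hv' (H.apply_apply_ne hu')
      · simp [hv'] at hv
    · simp [hu'] at hu
  · intro e he
    induction e with
    | _ u v =>
    rw [SimpleGraph.mem_edgeFinset, SimpleGraph.mem_edgeSet, hp.adj_iff] at he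
    rcases he with h | h
    · exact ⟨u, by simp [h], by simp [h]⟩
    · exact ⟨v, by simp [h], by simp [h, Sym2.eq_swap]⟩

theorem weight_parentForest [DecidableEq V] (w q : ℝ)
    (p : {p : V → V ⊕ Unit // IsTerminating p}) :
    q ^ (parentForest p).partition.parts.card * (parentForest p).weight (fun _ => w) =
      mapWeight w (fun _ => q) p.1 := by
  classical
  have h1 : (parentForest p).weight (fun _ => w) = w ^ #{v | ¬ p.1 v = Sum.inr ()} := by
    rw [RootedForest.weight, Finset.prod_const, ← card_edgeFinset_parentGraph p.2]
    congr!
  have h2 : (parentForest p).roots = ({v | p.1 v = Sum.inr ()} : Finset V) := by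
    ext; simp [mem_roots_parentForest]
  have h3 : ∀ v, Sum.elim (fun _ => w) (fun _ => q) (p.1 v) =
      if p.1 v = Sum.inr () then q else w := fun v => by rcases p.1 v with a | a <;> simp
  rw [card_parts_partition, h1, h2, mapWeight, Finset.prod_congr rfl fun v _ => h3 v,
    Finset.prod_ite, Finset.prod_const, Finset.prod_const]

open Classical in
theorem sum_loopErasedWeight [DecidableEq V] (G : SimpleGraph V) (w : Sym2 V → ℝ) (q : ℝ)
    (A : Finpartition (univ : Finset V) → Prop) :
    ∑ P with A P, loopErasedWeight G w q P =
      ∑ F : RootedForest G, if A F.partition then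
        q ^ F.partition.parts.card * F.weight w else 0 := by
  simp only [loopErasedWeight, Finset.mul_sum, Finset.sum_filter]
  rw [Finset.sum_congr rfl fun P _ => (show _ = ∑ F : RootedForest G,
    if F.partition = P then (if A F.partition then
        q ^ F.partition.parts.card * F.weight w else 0) else 0 from ?_), Finset.sum_comm]
  · simp
  · by_cases h : A P
    · rw [if_pos h]
      refine Finset.sum_congr rfl fun F _ => ?_
      by_cases hF : F.partition = P
      · subst hF; simp [h]
      · simp [hF]
    · rw [if_neg h, Finset.sum_eq_zero]
      intro F _
      by_cases hF : F.partition = P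
      · subst hF; simp [h]
      · simp [hF]

/-- Transfers an event on partitions to parent maps. `B` is a predicate on all maps, so it must
include termination. -/
theorem sum_loopErasedWeight_top [DecidableEq V] (w q : ℝ)
    (A : Finpartition (univ : Finset V) → Prop) [DecidablePred A]
    (B : (V → V ⊕ Unit) → Prop)
    (h : ∀ p, IsTerminating p ∧ (∀ hp, A (parentForest ⟨p, hp⟩).partition) ↔ B p) :
    ∑ P with A P, loopErasedWeight (⊤ : SimpleGraph V) (fun _ => w) q P =
      mapSum w (fun _ => q) B := by
  classical
  have h' : ∀ p : {p : V → V ⊕ Unit // IsTerminating p},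
      A (parentForest p).partition ↔ B p.1 := fun p => by
    rw [← h]
    exact ⟨fun H => ⟨p.2, fun _ => H⟩, fun H => H.2 p.2⟩
  have e := sum_loopErasedWeight (⊤ : SimpleGraph V) (fun _ => w) q A
  rw [← Function.Bijective.sum_comp ⟨parentForest_injective, parentForest_surjective⟩] at e
  simp only [weight_parentForest, h'] at e
  rw [mapSum, ← Finset.sum_filter_add_sum_filter_not univ IsTerminating,
    Finset.sum_subtype (p := IsTerminating) _ (by simp),
    Finset.sum_eq_zero (s := univ.filter fun p => ¬ IsTerminating p), add_zero, ← e]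
  · congr!
  · intro p hp
    exact if_neg fun hB => (mem_filter.1 hp).2 ((h p).2 hB).1

theorem part_ne_part_parentForest [DecidableEq V] (p : {p : V → V ⊕ Unit // IsTerminating p})
    (x y : V) : (parentForest p).partition.part x ≠ (parentForest p).partition.part y ↔
      LeadApart x y () p.1 := by
  rw [Ne, partition_part_eq_iff]
  obtain ⟨u, r, H⟩ := p.2 x
  obtain ⟨u', r', H'⟩ := p.2 y
  constructor
  · refine fun h => ⟨p.2, u, u', ?_, H, H'⟩
    rintro rfl
    exact h (H.reachable.trans H'.reachable.symm)
  · rintro ⟨-, a, a', ha, h, h'⟩ hr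
    exact ha (h.unique ((EndsAt.iff_of_reachable hr).2 h')).1

theorem pairPotential_top [DecidableEq V] (w q : ℝ) (x y : V) :
    pairPotential (⊤ : SimpleGraph V) (fun _ => w) q x y =
      mapSum w (fun _ => q) (LeadApart x y () : (V → V ⊕ Unit) → Prop) /
        mapSum w (fun _ => q) (IsTerminating : (V → V ⊕ Unit) → Prop) := by
  simp only [pairPotential, loopErasedMass, ← Finset.sum_div, loopErasedZ]
  congr 1
  · refine sum_loopErasedWeight_top w q _ _ fun p => ?_
    simp only [part_ne_part_parentForest]
    exact ⟨fun h => h.2 h.1, fun h => ⟨h.1, fun _ => h⟩⟩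
  · rw [← sum_loopErasedWeight_top w q (fun _ => True) _ fun p => by simp]
    simp

end Bridge

theorem completePotential_eq {m : ℕ} {w q : ℝ} (hq : 0 < q) (hw : 0 < w) {x y : Fin (m + 2)}
    (hxy : x ≠ y) :
    completePotential (m + 2) w q x y = ∑ i ∈ range (m + 1),
      q * w ^ i * (m.descFactorial i : ℝ) / (q + (m + 2) * w) ^ (i + 1) := by
  have hT : 0 < q + (m + 2) * w := by positivity
  have e : q + ((m + 1 : ℕ) + 1) * w = q + (m + 2) * w := by push_cast; ring
  rw [completePotential, pairPotential_top, mapSum_leadApart m _ _ _ _ _ hxy (by simp),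
    mapSum_isTerminating_eq (n := m + 1) _ _ (by simp)]
  simp only [Finset.univ_unique, Finset.sum_const, card_singleton, one_smul, e]
  rw [div_eq_iff (by positivity), mul_sum, sum_mul]
  refine Finset.sum_congr rfl fun i hi => ?_
  obtain ⟨j, rfl⟩ := Nat.exists_eq_add_of_le (Nat.lt_succ_iff.1 (mem_range.1 hi))
  rw [Nat.add_sub_cancel_left]
  field_simp
  ring

/-! ### Sums as integrals of step functions -/

section StepIntegral

theorem integral_Ioi_comp_floor {g : ℕ → ℝ} {M : ℕ} (hg : ∀ i, M ≤ i → g i = 0) :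
    ∫ u in Set.Ioi (0 : ℝ), g ⌊u⌋₊ = ∑ i ∈ range M, g i := by
  have h : ∀ u ∈ Set.Ici (0 : ℝ), g ⌊u⌋₊ =
      ∑ i ∈ range M, (Set.Ico (i : ℝ) (i + 1)).indicator (fun _ => g i) u := by
    intro u hu
    have hmem : ∀ i : ℕ, u ∈ Set.Ico (i : ℝ) (i + 1) ↔ ⌊u⌋₊ = i := fun i =>
      (Nat.floor_eq_iff hu).symm
    simp only [Set.indicator_apply, hmem, Finset.sum_ite_eq, mem_range]
    split_ifs with h
    · rfl
    · exact hg _ (not_lt.1 h)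
  have hvol : ∀ i : ℕ, Set.Ici (0 : ℝ) ∩ Set.Ico (i : ℝ) (i + 1) = Set.Ico (i : ℝ) (i + 1) :=
    fun i => Set.inter_eq_right.2 fun u hu => le_trans (Nat.cast_nonneg i) hu.1
  -- The closed half-line contains all the intervals `[i, i + 1)`, including the one starting at
  -- `0`.
  rw [← integral_Ici_eq_integral_Ioi, setIntegral_congr_fun measurableSet_Ici h,
    integral_finsetSum]
  · refine Finset.sum_congr rfl fun i _ => ?_
    rw [setIntegral_indicator measurableSet_Ico, hvol]
    simp
  · intro i _
    refine Integrable.integrableOn ((integrable_indicator_iff measurableSet_Ico).2 ?_)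
    exact integrableOn_const (by simp)

theorem integral_Ioi_mul_comp_floor_mul {g : ℕ → ℝ} {M : ℕ} (hg : ∀ i, M ≤ i → g i = 0) {s : ℝ}
    (hs : 0 < s) : ∫ t in Set.Ioi (0 : ℝ), s * g ⌊s * t⌋₊ = ∑ i ∈ range M, g i := by
  rw [← integral_Ioi_comp_floor hg, integral_const_mul]
  simpa using integral_comp_mul_left_Ioi' (fun u => g ⌊u⌋₊) 0 hs

end StepIntegral

/-! ### Exponential limits of products -/

section ExpLimits

theorem Real.exp_neg_div_one_sub_le {x δ : ℝ} (hx : 0 ≤ x) (hxδ : x ≤ δ) (hδ : δ < 1) :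
    Real.exp (-(x / (1 - δ))) ≤ 1 - x := by
  have h1 : 0 < 1 - x := by linarith
  have h2 : x / (1 - x) ≤ x / (1 - δ) := by gcongr
  have h3 : (1 - x)⁻¹ ≤ Real.exp (x / (1 - δ)) := by
    refine le_trans (le_of_eq ?_) ((Real.add_one_le_exp (x / (1 - x))).trans (Real.exp_le_exp.2 h2))
    field_simp
    ring
  rw [Real.exp_neg]
  exact inv_le_of_inv_le₀ h1 h3

/-- Squeeze each factor by `exp (-x / (1 - δ)) ≤ 1 - x ≤ exp (-x)`. It serves both the birthday-type
product and the geometric factor. -/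
theorem tendsto_prod_one_sub {x : ℕ → ℕ → ℝ} {h : ℕ → ℕ} {δ : ℕ → ℝ} {L : ℝ}
    (hx : ∀ n, ∀ i < h n, 0 ≤ x n i ∧ x n i ≤ δ n) (hδ : Tendsto δ atTop (𝓝 0))
    (hL : Tendsto (fun n => ∑ i ∈ range (h n), x n i) atTop (𝓝 L)) :
    Tendsto (fun n => ∏ i ∈ range (h n), (1 - x n i)) atTop (𝓝 (Real.exp (-L))) := by
  have hδ1 : ∀ᶠ n in atTop, δ n < 1 := hδ.eventually_lt_const one_pos
  have hlow : Tendsto (fun n => Real.exp (-((∑ i ∈ range (h n), x n i) / (1 - δ n)))) atTop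
      (𝓝 (Real.exp (-L))) := by
    have := (hL.div (tendsto_const_nhds.sub hδ) (by norm_num : (1 : ℝ) - 0 ≠ 0)).neg.rexp
    simpa using this
  refine tendsto_of_tendsto_of_tendsto_of_le_of_le' hlow hL.neg.rexp ?_ ?_
  · filter_upwards [hδ1] with n hn
    rw [Finset.sum_div, ← Finset.sum_neg_distrib, Real.exp_sum]
    refine Finset.prod_le_prod (fun _ _ => (Real.exp_pos _).le) fun i hi => ?_
    obtain ⟨h0, h1⟩ := hx n i (mem_range.1 hi)
    exact Real.exp_neg_div_one_sub_le h0 h1 hn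
  · filter_upwards [hδ1] with n hn
    rw [← Finset.sum_neg_distrib, Real.exp_sum]
    refine Finset.prod_le_prod (fun i hi => ?_) fun i _ => Real.one_sub_le_exp_neg _
    linarith [(hx n i (mem_range.1 hi)).2]

end ExpLimits

/-! ### The scaling limit and the Gaussian tail -/

section Limit

/-- The factor `k = m` vanishes, so the finite sum extends by zero to all indices, as the step
integral requires. -/
theorem prod_one_sub_eq_zero {m i : ℕ} (h : m + 1 ≤ i) :
    ∏ k ∈ range i, (1 - ((k : ℝ) + 2) / (m + 2)) = 0 := by
  refine Finset.prod_eq_zero (i := m) (mem_range.2 h) ?_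
  have : (m : ℝ) + 2 ≠ 0 := by positivity
  field_simp
  ring

theorem prod_one_sub_mem (m i : ℕ) :
    0 ≤ ∏ k ∈ range i, (1 - ((k : ℝ) + 2) / (m + 2)) ∧
      ∏ k ∈ range i, (1 - ((k : ℝ) + 2) / (m + 2)) ≤ 1 := by
  rcases le_or_gt (m + 1) i with h | h
  · simp [prod_one_sub_eq_zero h]
  · have hk : ∀ k ∈ range i, 0 ≤ 1 - ((k : ℝ) + 2) / (m + 2) := fun k hk => by
      have : (k : ℝ) ≤ m := by
        have := mem_range.1 hk
        exact_mod_cast (by omega : k ≤ m)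
      rw [sub_nonneg, div_le_one (by positivity)]
      linarith
    refine ⟨Finset.prod_nonneg hk, Finset.prod_le_one hk fun k _ => ?_⟩
    rw [sub_le_self_iff]
    positivity

theorem sum_range_add_two (h : ℕ) (N : ℝ) :
    ∑ k ∈ range h, ((k : ℝ) + 2) / N = (h : ℝ) * (h + 3) / (2 * N) := by
  induction h with
  | zero => simp
  | succ h ih =>
    rw [sum_range_succ, ih]
    push_cast
    rcases eq_or_ne N 0 with rfl | hN
    · simp
    · field_simp
      ring

theorem tendsto_sqrt_natCast_add_two : Tendsto (fun m : ℕ => √((m : ℝ) + 2)) atTop atTop :=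
  Real.tendsto_sqrt_atTop.comp (tendsto_atTop_add_const_right _ _ tendsto_natCast_atTop_atTop)

theorem tendsto_floor_sqrt_div {t : ℝ} (ht : 0 ≤ t) :
    Tendsto (fun m : ℕ => (⌊√((m : ℝ) + 2) * t⌋₊ : ℝ) / √((m : ℝ) + 2)) atTop (𝓝 t) := by
  simpa [Function.comp_def, mul_comm] using
    (tendsto_nat_floor_mul_div_atTop ht).comp tendsto_sqrt_natCast_add_two

theorem tendsto_prod_floor {t : ℝ} (ht : 0 ≤ t) :
    Tendsto (fun m : ℕ => ∏ k ∈ range ⌊√((m : ℝ) + 2) * t⌋₊, (1 - ((k : ℝ) + 2) / (m + 2)))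
      atTop (𝓝 (Real.exp (-(t ^ 2 / 2)))) := by
  have hs := tendsto_sqrt_natCast_add_two
  have hf := tendsto_floor_sqrt_div ht
  have hinv := hs.inv_tendsto_atTop
  have hsq : ∀ m : ℕ, √((m : ℝ) + 2) ≠ 0 := fun m => by positivity
  have hN : ∀ m : ℕ, (m : ℝ) + 2 = √((m : ℝ) + 2) ^ 2 := fun m =>
    (Real.sq_sqrt (by positivity)).symm
  refine tendsto_prod_one_sub
    -- The largest term has `k + 1` equal to the floor, hence numerator floor plus one.
    (δ := fun m : ℕ => ((⌊√((m : ℝ) + 2) * t⌋₊ : ℝ) + 1) / (m + 2)) ?_ ?_ ?_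
  · intro m i hi
    have : (i : ℝ) + 1 ≤ ⌊√((m : ℝ) + 2) * t⌋₊ := by exact_mod_cast hi
    refine ⟨by positivity, ?_⟩
    exact div_le_div_of_nonneg_right (by linarith) (by positivity)
  · have := (hf.mul hinv).add (hinv.pow 2)
    simp only [Pi.inv_apply] at this
    rw [mul_zero, zero_pow two_ne_zero, add_zero] at this
    refine this.congr fun m => ?_
    have := hsq m
    have e := hN m
    generalize ⌊√((m : ℝ) + 2) * t⌋₊ = k
    generalize √((m : ℝ) + 2) = s at e this ⊢
    rw [e]
    field_simp
  · have := ((hf.pow 2).div_const 2).add ((hf.mul hinv).mul_const (3 / 2))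
    simp only [Pi.inv_apply] at this
    rw [mul_zero, zero_mul, add_zero] at this
    refine this.congr fun m => ?_
    have := hsq m
    rw [sum_range_add_two]
    have e := hN m
    generalize ⌊√((m : ℝ) + 2) * t⌋₊ = k
    generalize √((m : ℝ) + 2) = s at e this ⊢
    rw [e]
    field_simp

theorem tendsto_one_sub_pow_floor {θ : ℕ → ℝ} {z t : ℝ} (ht : 0 ≤ t) (hθ : ∀ m, 0 ≤ θ m)
    (h : Tendsto (fun m : ℕ => √((m : ℝ) + 2) * θ m) atTop (𝓝 z)) :
    Tendsto (fun m : ℕ => (1 - θ m) ^ ⌊√((m : ℝ) + 2) * t⌋₊) atTop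
      (𝓝 (Real.exp (-(z * t)))) := by
  have hs := tendsto_sqrt_natCast_add_two
  have hf := tendsto_floor_sqrt_div ht
  have hsq : ∀ m : ℕ, √((m : ℝ) + 2) ≠ 0 := fun m => by positivity
  have := tendsto_prod_one_sub (x := fun m _ => θ m) (h := fun m => ⌊√((m : ℝ) + 2) * t⌋₊)
    (δ := θ) (L := z * t) (fun m i _ => ⟨hθ m, le_rfl⟩) ?_ ?_
  · simpa using this
  · have := h.mul hs.inv_tendsto_atTop
    rw [mul_zero] at this
    refine this.congr fun m => ?_
    have := hsq m
    simp only [Pi.inv_apply]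
    field_simp
  · refine (h.mul hf).congr fun m => ?_
    have := hsq m
    rw [Finset.sum_const, card_range, nsmul_eq_mul]
    field_simp

theorem tendsto_sum_mul_pow_mul_prod {θ : ℕ → ℝ} {z : ℝ} (hz : 0 < z) (hθ : ∀ m, 0 ≤ θ m)
    (hθ1 : ∀ m, θ m ≤ 1) (h : Tendsto (fun m : ℕ => √((m : ℝ) + 2) * θ m) atTop (𝓝 z)) :
    Tendsto (fun m : ℕ => ∑ i ∈ range (m + 1),
        θ m * (1 - θ m) ^ i * ∏ k ∈ range i, (1 - ((k : ℝ) + 2) / (m + 2))) atTop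
      (𝓝 (∫ t in Set.Ioi (0 : ℝ), z * Real.exp (-(z * t)) * Real.exp (-(t ^ 2 / 2)))) := by
  have hint : ∀ m : ℕ, ∫ t in Set.Ioi (0 : ℝ), √((m : ℝ) + 2) *
      (θ m * (1 - θ m) ^ ⌊√((m : ℝ) + 2) * t⌋₊ *
        ∏ k ∈ range ⌊√((m : ℝ) + 2) * t⌋₊, (1 - ((k : ℝ) + 2) / (m + 2))) =
      ∑ i ∈ range (m + 1),
        θ m * (1 - θ m) ^ i * ∏ k ∈ range i, (1 - ((k : ℝ) + 2) / (m + 2)) := fun m =>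
    integral_Ioi_mul_comp_floor_mul (M := m + 1)
      (g := fun i => θ m * (1 - θ m) ^ i * ∏ k ∈ range i, (1 - ((k : ℝ) + 2) / (m + 2)))
      (fun i hi => by simp only [prod_one_sub_eq_zero hi, mul_zero]) (by positivity)
  refine Tendsto.congr hint ?_
  refine tendsto_integral_filter_of_dominated_convergence
    -- Eventually `z / 2 ≤ √N θ ≤ 2 z`. The factor `exp 1` pays for the floor, which loses at most
    -- one power of `exp (-θ)`, with `θ ≤ 1`.
    (fun t => 2 * z * (Real.exp 1 * Real.exp (-(z / 2) * t))) ?_ ?_ ?_ ?_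
  · refine .of_forall fun m => Measurable.aestronglyMeasurable ?_
    refine (measurable_from_nat (f := fun i => √((m : ℝ) + 2) *
      (θ m * (1 - θ m) ^ i * ∏ k ∈ range i, (1 - ((k : ℝ) + 2) / (m + 2))))).comp ?_
    exact Nat.measurable_floor.comp (measurable_const_mul _)
  · filter_upwards [h.eventually_le_const (by linarith : z < 2 * z),
      h.eventually_const_le (by linarith : z / 2 < z)] with m h1 h2
    refine (ae_restrict_mem measurableSet_Ioi).mono fun t ht => ?_
    have ht : 0 < t := ht
    obtain ⟨hp0, hp1⟩ := prod_one_sub_mem m ⌊√((m : ℝ) + 2) * t⌋₊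
    have hone : 0 ≤ 1 - θ m := by linarith [hθ1 m]
    have hθm := hθ m
    rw [Real.norm_of_nonneg (by positivity)]
    have hpow : (1 - θ m) ^ ⌊√((m : ℝ) + 2) * t⌋₊ ≤ Real.exp 1 * Real.exp (-(z / 2) * t) := by
      calc (1 - θ m) ^ ⌊√((m : ℝ) + 2) * t⌋₊
          ≤ Real.exp (-θ m) ^ ⌊√((m : ℝ) + 2) * t⌋₊ := by
            gcongr
            exact Real.one_sub_le_exp_neg _
        _ ≤ Real.exp 1 * Real.exp (-(z / 2) * t) := by
            rw [← Real.exp_nat_mul, ← Real.exp_add, Real.exp_le_exp]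
            have h3 := (Nat.lt_floor_add_one (√((m : ℝ) + 2) * t)).le
            have h4 := mul_le_mul_of_nonneg_right h3 hθm
            have h5 := mul_le_mul_of_nonneg_right h2 ht.le
            have := hθ1 m
            linarith
    calc √((m : ℝ) + 2) * (θ m * (1 - θ m) ^ ⌊√((m : ℝ) + 2) * t⌋₊ *
          ∏ k ∈ range ⌊√((m : ℝ) + 2) * t⌋₊, (1 - ((k : ℝ) + 2) / (m + 2)))
        = (√((m : ℝ) + 2) * θ m) * ((1 - θ m) ^ ⌊√((m : ℝ) + 2) * t⌋₊ *
          ∏ k ∈ range ⌊√((m : ℝ) + 2) * t⌋₊, (1 - ((k : ℝ) + 2) / (m + 2))) := by ring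
      _ ≤ 2 * z * ((Real.exp 1 * Real.exp (-(z / 2) * t)) * 1) := by gcongr
      _ = _ := by ring
  · exact ((exp_neg_integrableOn_Ioi 0 (by positivity)).const_mul _).const_mul _
  · refine (ae_restrict_mem measurableSet_Ioi).mono fun t ht => ?_
    have ht : 0 ≤ t := le_of_lt ht
    refine ((h.mul (tendsto_one_sub_pow_floor ht hθ h)).mul (tendsto_prod_floor ht)).congr
      fun m => by ring

/-- Shift the tail integral by `z` and expand `(t + z)²`. -/
theorem integral_exp_mul_exp_eq_gaussianReal (z : ℝ) :
    ∫ t in Set.Ioi (0 : ℝ), z * Real.exp (-(z * t)) * Real.exp (-(t ^ 2 / 2)) =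
      √(2 * Real.pi) * z * Real.exp (z ^ 2 / 2) * (gaussianReal 0 1).real (Set.Ioi z) := by
  have h1 : (gaussianReal 0 1).real (Set.Ioi z) = ∫ x in Set.Ioi z, gaussianPDFReal 0 1 x := by
    rw [Measure.real, gaussianReal_apply_eq_integral _ one_ne_zero, ENNReal.toReal_ofReal]
    exact integral_nonneg fun x => gaussianPDFReal_nonneg _ _ _
  have h2 : ∫ x in Set.Ioi z, gaussianPDFReal 0 1 x =
      ∫ t in Set.Ioi (0 : ℝ), gaussianPDFReal 0 1 (t + z) := by
    rw [← (measurePreserving_add_right volume z).setIntegral_preimage_emb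
      (measurableEmbedding_addRight z)]
    simp
  rw [h1, h2, ← integral_const_mul]
  refine integral_congr_ae (.of_forall fun t => ?_)
  have h3 : √(2 * Real.pi) ≠ 0 := by positivity
  simp only [gaussianPDFReal, NNReal.coe_one, mul_one, sub_zero]
  have h4 : Real.exp (-(t + z) ^ 2 / 2) =
      Real.exp (-(z ^ 2 / 2)) * Real.exp (-(z * t)) * Real.exp (-(t ^ 2 / 2)) := by
    rw [← Real.exp_add, ← Real.exp_add]
    ring_nf
  rw [h4, Real.exp_neg (z ^ 2 / 2)]
  have h5 := (Real.exp_pos (z ^ 2 / 2)).ne'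
  field_simp

end Limit

theorem descFactorial_div_pow_eq_prod {m i : ℕ} (hi : i ≤ m) :
    (m.descFactorial i : ℝ) / ((m : ℝ) + 2) ^ i =
      ∏ k ∈ range i, (1 - ((k : ℝ) + 2) / (m + 2)) := by
  have h : (m : ℝ) + 2 ≠ 0 := by positivity
  rw [Nat.descFactorial_eq_prod_range, Nat.cast_prod, ← card_range i, ← Finset.prod_const,
    card_range, ← Finset.prod_div_distrib]
  refine Finset.prod_congr rfl fun k hk => ?_
  rw [Nat.cast_sub (by have := mem_range.1 hk; omega)]
  field_simp
  ring

theorem completePotential_eq_sum_prod {m : ℕ} {w q : ℝ} (hq : 0 < q) (hw : 0 < w)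
    {x y : Fin (m + 2)} (hxy : x ≠ y) :
    completePotential (m + 2) w q x y = ∑ i ∈ range (m + 1),
      q / (q + (m + 2) * w) * ((m + 2) * w / (q + (m + 2) * w)) ^ i *
        ∏ k ∈ range i, (1 - ((k : ℝ) + 2) / (m + 2)) := by
  have hT : q + (m + 2) * w ≠ 0 := by positivity
  have h : (m : ℝ) + 2 ≠ 0 := by positivity
  rw [completePotential_eq hq hw hxy]
  refine Finset.sum_congr rfl fun i hi => ?_
  rw [← descFactorial_div_pow_eq_prod (Nat.lt_succ_iff.1 (mem_range.1 hi)), div_pow, mul_pow]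
  field_simp
  ring

theorem tendsto_sqrt_mul_div {z : ℝ} {q w : ℕ → ℝ} (hz : 0 < z) (hq : ∀ N, 0 < q N)
    (hw : ∀ N, 0 < w N) (h : q ~[atTop] (fun N => w N * z * √(N : ℝ))) :
    Tendsto (fun m : ℕ => √((m : ℝ) + 2) *
      (q (m + 2) / (q (m + 2) + (m + 2) * w (m + 2)))) atTop (𝓝 z) := by
  rw [isEquivalent_iff_tendsto_one] at h
  · have h1 : Tendsto (fun m : ℕ => q (m + 2) / (w (m + 2) * z * √((m : ℝ) + 2))) atTop (𝓝 1) := by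
      have := h.comp (tendsto_add_atTop_nat 2)
      refine this.congr fun m => ?_
      simp
    have h2 := h1.mul_const z
    -- With `a = q / (w √N) → z`, one has `√N θ = a / (a / √N + 1)`.
    have h3 := h2.div ((h2.mul tendsto_sqrt_natCast_add_two.inv_tendsto_atTop).add_const 1)
      (by simp)
    simp only [mul_zero, zero_add, one_mul, div_one] at h3
    refine h3.congr fun m => ?_
    have e1 := hq (m + 2)
    have e2 := hw (m + 2)
    have e3 : 0 < √((m : ℝ) + 2) := by positivity
    have e4 : (m : ℝ) + 2 = √((m : ℝ) + 2) ^ 2 := (Real.sq_sqrt (by positivity)).symm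
    simp only [Pi.inv_apply, Pi.div_apply]
    generalize √((m : ℝ) + 2) = s at *
    rw [e4]
    have : q (m + 2) + s ^ 2 * w (m + 2) ≠ 0 := by positivity
    field_simp
  · filter_upwards [eventually_gt_atTop 0] with N hN
    have := hw N
    positivity

theorem theorem2p1 :
    (∀ (N : ℕ) (q w : ℝ), 1 ≤ N → 0 < q → 0 < w → ∀ x y : Fin N, x ≠ y →
      completePotential N w q x y =
        ∑ h ∈ Finset.Icc 1 (N - 1),
          q / (q + N * w) * ((N * w) / (q + N * w)) ^ (h - 1) *
            ∏ k ∈ Finset.Icc 2 h, (1 - (k : ℝ) / N)) ∧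
    (∀ (z : ℝ) (q w : ℕ → ℝ), 0 < z → (∀ N, 0 < q N) → (∀ N, 0 < w N) →
      w =Θ[atTop] (fun _ => (1 : ℝ)) →
      q ~[atTop] (fun N => w N * z * √(N : ℝ)) →
      -- the vertex set is `Fin N` with `N = n + 2`, so that two distinct vertices exist
      ∀ x y : ∀ n : ℕ, Fin (n + 2), (∀ n, x n ≠ y n) →
        Tendsto (fun n : ℕ => completePotential (n + 2) (w (n + 2)) (q (n + 2)) (x n) (y n))
          atTop
          (𝓝 (√(2 * Real.pi) * z * Real.exp (z ^ 2 / 2) *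
            (gaussianReal 0 1).real (Set.Ioi z)))) := by
  constructor
  · intro N q w _ hq hw x y hxy
    obtain ⟨m, rfl⟩ : ∃ m, N = m + 2 := by
      have h1 := x.2
      have h2 := y.2
      have h3 := Fin.val_ne_of_ne hxy
      exact ⟨N - 2, by omega⟩
    have hIcc : Finset.Icc 1 (m + 2 - 1) = Finset.Ico (0 + 1) (m + 1 + 1) := by
      ext; simp only [mem_Icc, mem_Ico]; omega
    rw [completePotential_eq_sum_prod hq hw hxy, hIcc, ← Finset.sum_Ico_add', ← range_eq_Ico]
    refine Finset.sum_congr rfl fun i _ => ?_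
    have hIcc' : Finset.Icc 2 (i + 1) = Finset.Ico (0 + 2) (i + 2) := by
      ext; simp only [mem_Icc, mem_Ico]; omega
    rw [hIcc', ← Finset.prod_Ico_add', ← range_eq_Ico]
    push_cast
    rfl
  · intro z q w hz hq hw _ h x y hxy
    rw [← integral_exp_mul_exp_eq_gaussianReal]
    have hT : ∀ m : ℕ, 0 < (m + 2) * w (m + 2) := fun m => mul_pos (by positivity) (hw _)
    refine (tendsto_sum_mul_pow_mul_prod
      (θ := fun m => q (m + 2) / (q (m + 2) + (m + 2) * w (m + 2))) hz
      (fun m => (div_pos (hq _) (add_pos (hq _) (hT m))).le)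
      (fun m => (div_le_one (add_pos (hq _) (hT m))).2 (by linarith [hT m]))
      (tendsto_sqrt_mul_div hz hq hw h)).congr fun m => ?_
    rw [completePotential_eq_sum_prod (hq _) (hw _) (hxy m)]
    have e : 1 - q (m + 2) / (q (m + 2) + (m + 2) * w (m + 2)) =
        (m + 2) * w (m + 2) / (q (m + 2) + (m + 2) * w (m + 2)) := by
      have := (add_pos (hq (m + 2)) (hT m)).ne'
      field_simp
      ring
    simp only [e]
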